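/- Fix a universe $\mathrm{Set}$ of small sets; "small" and "cocomplete" refer to it. Let $\mathcal C$ be a category with pullbacks, not necessarily small, and let $\mathrm{SET}\supseteq\mathrm{Set}$ be a larger universe with respect to which $\mathcal C$ is small. Let $\coprod\mathcal C$ be the coproduct completion of $\mathcal C$: its objects are small families of objects of $\mathcal C$, and a map $(A_i)_{i\in I}\to(B_j)_{j\in J'}$ is a function $f\colon I\to J'$ with maps $A_i\to B_{f(i)}$. Let $J$ be a Grothendieck topology on $\mathcal C$. A map of $\coprod\mathcal C$ is a $J$-cover if, for every component $B_j$ of its codomain, the family of its components with codomain $B_j$ generates a $J$-covering sieve. Assume that $J$ is given by small covers: every $J$-covering sieve on an object $X$ contains all components of some $J$-cover $U_0\to X$ with $U_0\in\coprod\mathcal C$. A $J$-hypercover of $X\in\mathcal C$ is a semi-simplicial object $U_\bullet$ of $\coprod\mathcal C$ augmented by $X$ (viewed as a one-element family), all of whose matching maps $U_n\to M_nU$, $n\ge 0$, are $J$-covers; here $M_0U=X$, $M_1U=U_0\times_XU_0$, and in general $M_nU$ is the limit in $\coprod\mathcal C$ of the diagram of all proper faces of the $n$-simplex (including the empty face,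 which gives $X$). Write $U_n=(U_n^i)_{i\in I_n}$, and let $\operatorname{El}U_\bullet$ be the diagram in $\mathcal C$ indexed by the category of elements of $I_\bullet$ that sends $(n,i)$, $n\ge0$, to $U_n^i$. A functor $K\colon\mathcal C\to\mathcal D$ turns $J$-hypercovers to colimit cocones if, for every $X$ and every $J$-hypercover $U_\bullet$ of $X$, the augmentation makes $KX$ a colimit of $K\circ\operatorname{El}U_\bullet$. Let $\tilde y\colon\mathcal C\to\mathrm{SH}_J(\mathcal C)$ be the Yoneda embedding followed by sheafification, with values in the $J$-sheaves $\mathcal C^{\mathrm{op}}\to\mathrm{SET}$, and let the category $\mathrm{Sh}_J(\mathcal C)\subseteq\mathrm{SH}_J(\mathcal C)$ of small $J$-sheaves be the full subcategory obtained as the closure of the image of $\tilde y$ under isomorphisms and small colimits in $\mathrm{SH}_J(\mathcal C)$. **Theorem.** Let $\mathcal D$ be a cocomplete category, let $[\mathcal C,\mathcal D]_J$ be the category of functors $\mathcal C\to\mathcal D$ that turn $J$-hypercovers to colimit cocones, and let $[\mathrm{Sh}_J(\mathcal C),\mathcal D]_{\mathrm{ccts}}$ be the category of functors $\mathrm{Sh}_J(\mathcal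 C)\to\mathcal D$ that preserve small colimits (both with all natural transformations as morphisms). If $L$ lies in the latter then $L\circ\tilde y$ lies in the former, and the resulting restriction functor $[\mathrm{Sh}_J(\mathcal C),\mathcal D]_{\mathrm{ccts}}\to[\mathcal C,\mathcal D]_J$ has a left adjoint that sends each $K$ to its pointwise left Kan extension along $\tilde y$ (the unit of the adjunction being the universal transformation of the Kan extension); the unit and the counit of this adjunction are isomorphisms. So left Kan extension and restriction form an adjoint equivalence $$[\mathcal C,\mathcal D]_J\simeq[\mathrm{Sh}_J(\mathcal C),\mathcal D]_{\mathrm{ccts}}.$$ -/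

import Mathlib

open CategoryTheory CategoryTheory.Limits Opposite

universe w v u v₂ u₂

namespace LargeSite

/-! ### Covers in the coproduct completion

`FormalCoproduct.{w} C` is the coproduct completion of `C`: its objects are families of objects of
`C` indexed by a (small) set, i.e. by a type in `Type w`. The universe `w` plays the role of the
universe of small sets; nothing is assumed on the size of `C` relative to `w`. -/

section Covers

variable {C : Type u} [Category.{v} C] (J : GrothendieckTopology C)

/-- A map `p : A ⟶ B` of the coproduct completion is a `J`-cover if, for every index `b` of `B`,
the components `A.obj a ⟶ B.obj b` of `p` with `a` lying over `b` generate a `J`-covering sieve. -/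
def IsCover {A B : FormalCoproduct.{w} C} (p : A ⟶ B) : Prop :=
  ∀ b : B.I,
    Sieve.ofArrows (fun a : {a : A.I // p.f a = b} => A.obj a.1)
      (fun a => p.φ a.1 ≫ (B.objIsoOfEq a.2).hom) ∈ J (B.obj b)

/-- The topology `J` is given by small covers: every `J`-covering sieve contains a `J`-cover
that is indexed by a small set. -/
def HasSmallCovers : Prop :=
  ∀ (X : C) (S : Sieve X), S ∈ J X →
    ∃ (A : FormalCoproduct.{w} C) (p : A ⟶ (FormalCoproduct.incl C).obj X),
      IsCover J p ∧ ∀ a : A.I, S (p.φ a)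

end Covers

/-! ### Augmented semi-simplicial objects and hypercovers -/

section Hypercovers

variable {C : Type u} [Category.{v} C]

variable (C) in
/-- A semi-simplicial object `… U₁ ⇉ U₀` of the coproduct completion of `C`, augmented by the
object `X` of `C`. -/
structure AugSemiSimplicial (X : C) where
  /-- The semi-simplicial object. -/
  U : SemiSimplexCategoryᵒᵖ ⥤ FormalCoproduct.{w} C
  /-- The augmentation. -/
  aug : U ⟶ (Functor.const _).obj ((FormalCoproduct.incl C).obj X)

namespace AugSemiSimplicial

variable {X : C} (U : AugSemiSimplicial.{w} C X)

/-- The object of `n`-simplices. -/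
abbrev simplices (n : ℕ) : FormalCoproduct.{w} C := U.U.obj (op (SemiSimplexCategory.mk n))

/-- A matching family of dimension `n` with apex `T`: a cone with apex `T` over the diagram of all
proper faces of an `n`-simplex of `U`, the empty face (which is sent to `X`) included. -/
@[ext]
structure MatchingFamily (n : ℕ) (T : FormalCoproduct.{w} C) where
  /-- The component at the empty face. -/
  base : T ⟶ (FormalCoproduct.incl C).obj X
  /-- The component at a proper non-empty face. -/
  face (m : SemiSimplexCategory) (hm : m.len < n) (f : m ⟶ SemiSimplexCategory.mk n) :
    T ⟶ U.U.obj (op m)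
  face_base (m : SemiSimplexCategory) (hm : m.len < n) (f : m ⟶ SemiSimplexCategory.mk n) :
    face m hm f ≫ U.aug.app (op m) = base
  face_face (m k : SemiSimplexCategory) (hm : m.len < n) (hk : k.len < n)
    (f : m ⟶ SemiSimplexCategory.mk n) (g : k ⟶ m) :
    face m hm f ≫ U.U.map g.op = face k hk (g ≫ f)

/-- The matching family formed by the faces of the `n`-simplices of `U`. -/
def boundary (n : ℕ) : U.MatchingFamily n (U.simplices n) where
  base := U.aug.app _
  face _ _ f := U.U.map f.op
  face_base m _ f := by simp
  face_face m k _ _ f g := by rw [op_comp, Functor.map_comp]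

variable {U} in
/-- Restriction of a matching family along a map of apexes. -/
def MatchingFamily.comp {n : ℕ} {T T' : FormalCoproduct.{w} C} (h : T' ⟶ T)
    (t : U.MatchingFamily n T) : U.MatchingFamily n T' where
  base := h ≫ t.base
  face m hm f := h ≫ t.face m hm f
  face_base m hm f := by rw [Category.assoc, t.face_base]
  face_face m k hm hk f g := by rw [Category.assoc, t.face_face m k hm hk f g]

variable {U} in
/-- The matching family `t` with apex `M` is universal, i.e. `M`, with the projections given by
`t`, is the matching object `MₙU`. -/
def MatchingFamily.IsUniversal {n : ℕ} {M : FormalCoproduct.{w} C}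
    (t : U.MatchingFamily n M) : Prop :=
  ∀ (T : FormalCoproduct.{w} C) (s : U.MatchingFamily n T), ∃! h : T ⟶ M, t.comp h = s

/-- An augmented semi-simplicial object of the coproduct completion is a `J`-hypercover if all its
matching maps `Uₙ ⟶ MₙU`, `n ≥ 0`, are `J`-covers. Here `M₀U = X`, `M₁U = U₀ ×_X U₀`, etc. -/
def IsHypercover (J : GrothendieckTopology C) : Prop :=
  ∀ n : ℕ, ∃ (M : FormalCoproduct.{w} C) (t : U.MatchingFamily n M) (p : U.simplices n ⟶ M),
    t.IsUniversal ∧ t.comp p = U.boundary n ∧ IsCover J p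

/-- Auxiliary to the construction of `El U`: identities of the coproduct completion. -/
lemma component_id {A : FormalCoproduct.{w} C} (p : A ⟶ A) (hp : p = 𝟙 A) (i : A.I)
    (h : p.f i = i) : p.φ i ≫ (A.objIsoOfEq h).hom = 𝟙 (A.obj i) := by
  subst hp
  exact Category.comp_id _

/-- Auxiliary to the construction of `El U`: composites in the coproduct completion. -/
lemma component_comp {A B E : FormalCoproduct.{w} C} (p : A ⟶ B) (q : B ⟶ E) (r : A ⟶ E)
    (hr : r = p ≫ q) {i : A.I} {j : B.I} {k : E.I} (hj : p.f i = j) (hk : q.f j = k)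
    (hik : r.f i = k) :
    r.φ i ≫ (E.objIsoOfEq hik).hom =
      (p.φ i ≫ (B.objIsoOfEq hj).hom) ≫ q.φ j ≫ (E.objIsoOfEq hk).hom := by
  subst hr hj hk
  simp

/-- The semi-simplicial set of indices of `U`. -/
def index : SemiSimplexCategoryᵒᵖ ⥤ Type w where
  obj n := (U.U.obj n).I
  map f := ↾(U.U.map f).f
  map_id n := by rw [U.U.map_id]; rfl
  map_comp f g := by rw [U.U.map_comp]; rfl

/-- The diagram `El U` in `C`, indexed by the pairs `(n, i)` with `i` an index of `Uₙ`; it sends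
`(n, i)` to the component `Uₙⁱ`. -/
def el : U.index.Elements ⥤ C where
  obj a := (U.U.obj a.1).obj a.2
  map {a b} f := (U.U.map f.1).φ a.2 ≫ ((U.U.obj b.1).objIsoOfEq f.2).hom
  map_id a := component_id _ (U.U.map_id a.1) _ _
  map_comp f g := component_comp _ _ _ (U.U.map_comp f.1 g.1) f.2 g.2 _

/-- The cocone on `K ∘ El U` with apex `K X` induced by the augmentation. -/
def cocone {D : Type u₂} [Category.{v₂} D] (K : C ⥤ D) : Cocone (U.el ⋙ K) where
  pt := K.obj X
  ι :=
    { app := fun a => K.map ((U.aug.app a.1).φ a.2)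
      naturality := fun a b f => by
        have e := component_comp (U.U.map f.1) (U.aug.app b.1) (U.aug.app a.1)
          (by simp) f.2 rfl rfl
        have e' : U.el.map f ≫ (U.aug.app b.1).φ b.2 = (U.aug.app a.1).φ a.2 :=
          (congrArg (U.el.map f ≫ ·) (Category.comp_id _).symm).trans
            (e.symm.trans (Category.comp_id _))
        exact (K.map_comp _ _).symm.trans ((congrArg K.map e').trans (Category.comp_id _).symm) }

end AugSemiSimplicial

/-- The functors `K : C ⥤ D` that turn `J`-hypercovers to colimit cocones. -/
def turnsHypercoversToColimits (J : GrothendieckTopology C) (D : Type u₂) [Category.{v₂} D] :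
    ObjectProperty (C ⥤ D) :=
  fun K => ∀ (X : C) (U : AugSemiSimplicial.{w} C X), U.IsHypercover J →
    Nonempty (IsColimit (U.cocone K))

end Hypercovers

/-! ### Small sheaves

Large sets are the elements of `Type (max u v w)`: it contains the small sets, and `C` is small
with respect to it. -/

section SmallSheaves

variable {C : Type u} [Category.{v} C] (J : GrothendieckTopology C)

/-- The sheafified Yoneda embedding of `C` into the `J`-sheaves of large sets. -/
noncomputable def sheafifiedYoneda : C ⥤ Sheaf J (Type (max u v w)) :=
  uliftYoneda.{max u w} ⋙ presheafToSheaf J (Type (max u v w))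

/-- Small `J`-sheaves: the closure of the sheafified representables under small colimits in the
category of `J`-sheaves of large sets. -/
def isSmallSheaf : ObjectProperty (Sheaf J (Type (max u v w))) :=
  (sheafifiedYoneda.{w} J).essImage.colimitsClosure (fun A : Cat.{w, w} => A)

/-- The category of small `J`-sheaves, a full subcategory of the category of `J`-sheaves. -/
abbrev SmallSheaf := (isSmallSheaf.{w} J).FullSubcategory

/-- The sheafified Yoneda embedding of `C` into the small `J`-sheaves. -/
noncomputable def smallYoneda : C ⥤ SmallSheaf.{w} J :=
  (isSmallSheaf.{w} J).lift (sheafifiedYoneda.{w} J) fun X =>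
    ObjectProperty.le_colimitsClosure _ _ _ ((sheafifiedYoneda.{w} J).obj_mem_essImage X)

/-- The cocontinuous functors (those that preserve small colimits) from small sheaves to `D`. -/
def cocontinuous (D : Type u₂) [Category.{v₂} D] : ObjectProperty (SmallSheaf.{w} J ⥤ D) :=
  fun L => PreservesColimitsOfSize.{w, w} L

/-- Restriction along `C ⥤ SmallSheaf J`, as a functor from cocontinuous functors to functors that
turn `J`-hypercovers to colimit cocones, once it is known to take its values there. -/
noncomputable def restriction (D : Type u₂) [Category.{v₂} D]
    (h : ∀ L : SmallSheaf.{w} J ⥤ D, cocontinuous.{w} J D L →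
      turnsHypercoversToColimits.{w} J D (smallYoneda.{w} J ⋙ L)) :
    (cocontinuous.{w} J D).FullSubcategory ⥤
      (turnsHypercoversToColimits.{w} J D).FullSubcategory :=
  (turnsHypercoversToColimits.{w} J D).lift
    ((cocontinuous.{w} J D).ι ⋙ (Functor.whiskeringLeft _ _ D).obj (smallYoneda.{w} J))
    (fun L => h L.obj L.property)

end SmallSheaves

end LargeSite

-- Write D(K-, d) for the presheaf sending X to the set of maps K X ⟶ d. The hypercover condition on
-- K makes every D(K-, d) a sheaf. Indeed the Čech nerve of a small cover is a hypercover, and a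
-- matching family for the cover is a cocone on its diagram of elements (`isSheafFor_of_isCover`);
-- pulling back small covers then handles all covering sieves. Conversely, sheaves satisfy descent
-- along hypercovers (`existsUnique_of_isSheaf`), where only dimensions 0 and 1 matter: vertices
-- cover X, and edges locally join vertices over the same point. Hence the sheafified Yoneda
-- embedding, and its composite with any cocontinuous functor, satisfies the condition.
--
-- Cocones with vertex d on the diagram defining the left Kan extension of K at F are the maps from
-- F to D(K-, d) (`coconeEquiv`). That diagram may be large, so cocompleteness of D does not
-- directly give its colimit. But the F for which these maps are corepresentable in d include the
-- sheafified representables, corepresented by K X, and are closed under small colimits; so they are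
-- all the small sheaves. The bijection between maps Lan F ⟶ d and maps F ⟶ D(K-, d) is a relative
-- adjunction: it makes Lan cocontinuous and, at representables, the unit invertible. The counit is
-- then invertible on representables by a triangle identity, and everywhere by cocontinuity.
--
-- Hom-sets of D need not lie in the universe of values of the small sheaves, so these maps are
-- formed after a change of universe, which has to commute with sheafification.

universe t

namespace LargeSite

/-! ### Generalized components of formal coproducts, and covers -/

section Formal

variable {C : Type u} [Category.{v} C]

/-- The inclusion of a component in a formal coproduct. -/
def componentι (A : FormalCoproduct.{w} C) (i : A.I) :
    (FormalCoproduct.incl C).obj (A.obj i) ⟶ A :=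
  FormalCoproduct.Hom.fromIncl i (𝟙 _)

/-- The component of a map from an object of `C` to a formal coproduct. -/
def homComponent {A : FormalCoproduct.{w} C} {Z : C}
    (q : (FormalCoproduct.incl C).obj Z ⟶ A) : Z ⟶ A.obj (q.f ⟨⟩) :=
  q.φ ⟨⟩

lemma incl_map_comp_componentι {A : FormalCoproduct.{w} C} {Z : C}
    (q : (FormalCoproduct.incl C).obj Z ⟶ A) :
    (FormalCoproduct.incl C).map (homComponent q) ≫ componentι A (q.f ⟨⟩) = q := by
  refine FormalCoproduct.hom_ext rfl fun _ => ?_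
  exact (Category.comp_id _).trans (Category.comp_id _)

lemma exists_component {A : FormalCoproduct.{w} C} {Z : C}
    (q : (FormalCoproduct.incl C).obj Z ⟶ A) :
    ∃ (i : A.I) (r : Z ⟶ A.obj i), (FormalCoproduct.incl C).map r ≫ componentι A i = q :=
  ⟨_, homComponent q, incl_map_comp_componentι q⟩

/-- The component in `C` of a map between objects of `C`, viewed as formal coproducts. -/
def inclPreimage {Z X : C}
    (q : (FormalCoproduct.incl.{w} C).obj Z ⟶ (FormalCoproduct.incl C).obj X) : Z ⟶ X :=
  q.φ ⟨⟩

/-- The value at a generalized component `q` of a family of sections of a presheaf over the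
components of a formal coproduct. -/
def familyEval (P : Cᵒᵖ ⥤ Type t) {A : FormalCoproduct.{w} C}
    (x : ∀ i, P.obj (op (A.obj i))) {Z : C} (q : (FormalCoproduct.incl C).obj Z ⟶ A) :
    P.obj (op Z) :=
  P.map (homComponent q).op (x (q.f ⟨⟩))

lemma familyEval_comp (P : Cᵒᵖ ⥤ Type t) {A : FormalCoproduct.{w} C}
    (x : ∀ i, P.obj (op (A.obj i))) {Z Z' : C} (f : Z' ⟶ Z)
    (q : (FormalCoproduct.incl C).obj Z ⟶ A) :
    familyEval P x ((FormalCoproduct.incl C).map f ≫ q) = P.map f.op (familyEval P x q) :=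
  ConcreteCategory.congr_hom (P.map_comp (homComponent q).op f.op) (x (q.f ⟨⟩))

lemma familyEval_componentι (P : Cᵒᵖ ⥤ Type t) {A : FormalCoproduct.{w} C}
    (x : ∀ i, P.obj (op (A.obj i))) (i : A.I) :
    familyEval P x (componentι A i) = x i :=
  ConcreteCategory.congr_hom (P.map_id (op (A.obj i))) (x i)

variable {J : GrothendieckTopology C}

lemma isCover_incl_iff {A : FormalCoproduct.{w} C} {X : C}
    (p : A ⟶ (FormalCoproduct.incl C).obj X) :
    IsCover J p ↔ Sieve.ofArrows A.obj (fun a => inclPreimage (componentι A a ≫ p)) ∈ J X := by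
  have e (b : ((FormalCoproduct.incl.{w} C).obj X).I) (a : {a : A.I // p.f a = b}) :
      p.φ a.1 ≫ (((FormalCoproduct.incl C).obj X).objIsoOfEq a.2).hom =
        inclPreimage (componentι A a ≫ p) :=
    (Category.comp_id (p.φ a.1)).trans (Category.id_comp (p.φ a.1)).symm
  constructor
  · intro h
    refine J.superset_covering ((Sieve.generate_le_iff _ _).2 ?_) (h ⟨⟩)
    rintro _ _ ⟨a⟩
    erw [e ⟨⟩ a]
    exact Sieve.ofArrows_mk _ _ a.1
  · intro h b
    refine J.superset_covering ((Sieve.generate_le_iff _ _).2 ?_) h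
    rintro _ _ ⟨a⟩
    exact e b ⟨a, rfl⟩ ▸ Sieve.ofArrows_mk _ (fun a : {a : A.I // p.f a = b} =>
        p.φ a.1 ≫ (((FormalCoproduct.incl C).obj X).objIsoOfEq a.2).hom) ⟨a, rfl⟩

/-- Generalized components of the codomain of a cover lift locally. -/
lemma IsCover.local_lift {A B : FormalCoproduct.{w} C} {p : A ⟶ B} (hp : IsCover J p) {Z : C}
    (b : (FormalCoproduct.incl C).obj Z ⟶ B) :
    ∃ S ∈ J Z, ∀ ⦃Y : C⦄ (f : Y ⟶ Z), S f →
      ∃ q : (FormalCoproduct.incl C).obj Y ⟶ A, q ≫ p = (FormalCoproduct.incl C).map f ≫ b := by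
  refine ⟨_, J.pullback_stable (b.φ ⟨⟩) (hp (b.f ⟨⟩)), ?_⟩
  rintro Y f ⟨_, g, _, ⟨⟨a, ha⟩⟩, e⟩
  refine ⟨FormalCoproduct.Hom.fromIncl a g, ?_⟩
  refine FormalCoproduct.hom_ext (funext fun _ => ha) fun _ => ?_
  exact (Category.assoc _ _ _).trans e

lemma isCover_id (A : FormalCoproduct.{w} C) : IsCover J (𝟙 A) := by
  intro b
  have : Sieve.ofArrows (fun a : {a : A.I // (𝟙 A : A ⟶ A).f a = b} => A.obj a.1)
      (fun a => (𝟙 A : A ⟶ A).φ a.1 ≫ (A.objIsoOfEq a.2).hom) = ⊤ := by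
    rw [← Sieve.id_mem_iff_eq_top]
    have := Sieve.ofArrows_mk _ (fun a : {a : A.I // (𝟙 A : A ⟶ A).f a = b} =>
        (𝟙 A : A ⟶ A).φ a.1 ≫ (A.objIsoOfEq a.2).hom) ⟨b, rfl⟩
    convert this
    exact (Category.comp_id _).symm
  rw [this]
  exact J.top_mem _

end Formal

/-! ### Vertices of simplices -/

/-- The inclusion of a vertex of a simplex. -/
def vertexHom (n : SemiSimplexCategory) (i : Fin (n.len + 1)) : SemiSimplexCategory.mk 0 ⟶ n :=
  SemiSimplexCategory.homEquiv.symm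
    (OrderEmbedding.ofStrictMono (fun _ : Fin (0 + 1) => i)
      (fun a b h => absurd h (by simp [Subsingleton.elim (α := Fin 1) a b])))

lemma homEquiv_vertexHom (n : SemiSimplexCategory) (i : Fin (n.len + 1)) (j) :
    SemiSimplexCategory.homEquiv (vertexHom n i) j = i := by
  rw [vertexHom, Equiv.apply_symm_apply]
  rfl

lemma vertexHom_comp {m n : SemiSimplexCategory} (i : Fin (m.len + 1)) (f : m ⟶ n) :
    vertexHom m i ≫ f = vertexHom n (SemiSimplexCategory.homEquiv f i) := by
  refine SemiSimplexCategory.hom_ext (DFunLike.ext _ _ fun j => ?_)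
  rw [homEquiv_vertexHom, SemiSimplexCategory.homEquiv_comp]
  change SemiSimplexCategory.homEquiv f (SemiSimplexCategory.homEquiv (vertexHom m i) j) = _
  rw [homEquiv_vertexHom]

/-! ### The Čech nerve of a cover is a hypercover -/

section Cech

variable {C : Type u} [Category.{v} C] [HasPullbacks C]

/-- The Čech nerve consists of powers of `p` in the slice over X; pullbacks supply them without any
products in the category itself. -/
lemma hasFiniteProducts_over (B : C) : HasFiniteProducts (Over B) :=
  haveI : HasBinaryProducts (Over B) := Over.ConstructProducts.over_binaryProduct_of_pullback
  hasFiniteProducts_of_has_binary_and_terminal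

attribute [local instance] hasFiniteProducts_over

variable {X : C} {A : FormalCoproduct.{w} C} (p : A ⟶ (FormalCoproduct.incl C).obj X)

/-- The augmented semi-simplicial object underlying the Čech nerve of `p`. -/
noncomputable def cech : AugSemiSimplicial.{w} C X where
  U := SemiSimplexCategory.toSimplexCategory.op ⋙ cechNerveTerminalFrom (Over.mk p) ⋙ Over.forget _
  aug :=
    { app := fun n => ((cechNerveTerminalFrom (Over.mk p)).obj
        (SemiSimplexCategory.toSimplexCategory.op.obj n)).hom
      naturality := fun _ _ f => (Over.w ((cechNerveTerminalFrom (Over.mk p)).map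
        (SemiSimplexCategory.toSimplexCategory.op.map f))).trans (Category.comp_id _).symm }

/-- The projections of the Čech nerve. -/
noncomputable def cechVertex (n : SemiSimplexCategory) (i : Fin (n.len + 1)) :
    (cech p).U.obj (op n) ⟶ A :=
  (Pi.π (fun _ : Fin (n.len + 1) => Over.mk p) i).left

lemma cechVertex_comp (n : SemiSimplexCategory) (i : Fin (n.len + 1)) :
    cechVertex p n i ≫ p = (cech p).aug.app (op n) :=
  Over.w (Pi.π (fun _ : Fin (n.len + 1) => Over.mk p) i)

lemma cech_map_cechVertex {m n : SemiSimplexCategory} (f : m ⟶ n) (i : Fin (m.len + 1)) :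
    (cech p).U.map f.op ≫ cechVertex p m i =
      cechVertex p n (SemiSimplexCategory.homEquiv f i) :=
  congrArg CommaMorphism.left (Pi.lift_π (fun i : Fin (m.len + 1) =>
    Pi.π (fun _ : Fin (n.len + 1) => Over.mk p) (SemiSimplexCategory.homEquiv f i)) i)

variable {p} in
lemma cech_hom_ext {n : SemiSimplexCategory} {T : FormalCoproduct.{w} C}
    {g h : T ⟶ (cech p).U.obj (op n)}
    (e : ∀ i, g ≫ cechVertex p n i = h ≫ cechVertex p n i) : g = h := by
  have eb : h ≫ (cech p).aug.app (op n) = g ≫ (cech p).aug.app (op n) := by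
    rw [← cechVertex_comp p n 0, ← Category.assoc, ← e 0, Category.assoc]
  let P := ∏ᶜ fun _ : Fin (n.len + 1) => Over.mk p
  let g' : Over.mk (g ≫ (cech p).aug.app (op n)) ⟶ P := Over.homMk g rfl
  let h' : Over.mk (g ≫ (cech p).aug.app (op n)) ⟶ P := Over.homMk h eb
  have : g' = h' := Pi.hom_ext _ _ fun i => Over.OverMorphism.ext (e i)
  exact congrArg CommaMorphism.left this

lemma cech_exists_lift {n : SemiSimplexCategory} {T : FormalCoproduct.{w} C}
    (r : T ⟶ (FormalCoproduct.incl C).obj X) (q : Fin (n.len + 1) → (T ⟶ A))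
    (hq : ∀ i, q i ≫ p = r) :
    ∃ g : T ⟶ (cech p).U.obj (op n), ∀ i, g ≫ cechVertex p n i = q i := by
  let g : Over.mk r ⟶ ∏ᶜ fun _ : Fin (n.len + 1) => Over.mk p :=
    Pi.lift fun i => Over.homMk (q i) (hq i)
  exact ⟨g.left, fun i => congrArg CommaMorphism.left
    (Pi.lift_π (fun i => (Over.homMk (q i) (hq i) : Over.mk r ⟶ Over.mk p)) i)⟩

/-- A map into stage n is a tuple of n + 1 maps to A over X. For n > 0 the vertices are proper
faces, so a matching family is rebuilt from its values at the vertices. -/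
lemma cech_boundary_isUniversal {n : ℕ} (hn : 0 < n) : ((cech p).boundary n).IsUniversal := by
  intro T s
  let q (i : Fin (n + 1)) : T ⟶ A :=
    s.face (SemiSimplexCategory.mk 0) hn (vertexHom (SemiSimplexCategory.mk n) i) ≫
      cechVertex p (SemiSimplexCategory.mk 0) 0
  obtain ⟨g, hg⟩ := cech_exists_lift p (n := SemiSimplexCategory.mk n) s.base q fun i => by
    rw [Category.assoc, cechVertex_comp, s.face_base]
  refine ⟨g, ?_, ?_⟩
  · apply AugSemiSimplicial.MatchingFamily.ext
    · change g ≫ (cech p).aug.app _ = _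
      rw [← cechVertex_comp p _ 0, ← Category.assoc, hg, Category.assoc, cechVertex_comp,
        s.face_base]
    · funext m hm f
      change g ≫ (cech p).U.map f.op = _
      refine cech_hom_ext fun i => ?_
      rw [Category.assoc, cech_map_cechVertex, hg]
      have := cech_map_cechVertex p (vertexHom m i) 0
      rw [homEquiv_vertexHom] at this
      rw [← this, ← Category.assoc, s.face_face m _ hm hn, vertexHom_comp]
  · rintro h rfl
    refine cech_hom_ext fun i => ?_
    rw [hg]
    change _ = (h ≫ (cech p).U.map _) ≫ _
    rw [Category.assoc, cech_map_cechVertex, homEquiv_vertexHom]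

/-- Stage 0 is a one-fold product in the slice, isomorphic to A but not equal to it; this map makes
the comparison. -/
lemma exists_cech_diagonal : ∃ g : A ⟶ (cech p).U.obj (op (SemiSimplexCategory.mk 0)),
    ∀ i, g ≫ cechVertex p (SemiSimplexCategory.mk 0) i = 𝟙 A :=
  cech_exists_lift p p (fun _ => 𝟙 A) fun _ => Category.id_comp p

variable {J : GrothendieckTopology C} {p}

/-- In positive dimension the matching map is an identity. In dimension 0 it is the augmentation,
through which the cover `p` factors. -/
lemma IsCover.isHypercover_cech (hp : IsCover J p) : (cech p).IsHypercover J := by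
  intro n
  obtain rfl | hn := Nat.eq_zero_or_pos n
  · refine ⟨(FormalCoproduct.incl C).obj X,
      { base := 𝟙 _
        face := fun m hm => absurd hm (Nat.not_lt_zero _)
        face_base := fun m hm => absurd hm (Nat.not_lt_zero _)
        face_face := fun m _ hm => absurd hm (Nat.not_lt_zero _) },
      (cech p).aug.app _, ?_, ?_, ?_⟩
    · intro T s
      refine ⟨s.base, ?_, ?_⟩
      · apply AugSemiSimplicial.MatchingFamily.ext
        · exact Category.comp_id _
        · funext m hm
          exact absurd hm (Nat.not_lt_zero _)
      · rintro h rfl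
        exact (Category.comp_id h).symm
    · apply AugSemiSimplicial.MatchingFamily.ext
      · exact Category.comp_id _
      · funext m hm
        exact absurd hm (Nat.not_lt_zero _)
    · obtain ⟨σ, hσ⟩ := exists_cech_diagonal p
      have hσ' : σ ≫ (cech p).aug.app _ = p := by
        rw [← cechVertex_comp p _ 0, ← Category.assoc, hσ, Category.id_comp]
      rw [isCover_incl_iff] at hp ⊢
      refine J.superset_covering ((Sieve.generate_le_iff _ _).2 ?_) hp
      rintro _ _ ⟨a⟩
      refine ⟨_, σ.φ a, _, ⟨σ.f a⟩, ?_⟩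
      have : inclPreimage (componentι A a ≫ p) =
          inclPreimage (componentι A a ≫ σ ≫ (cech p).aug.app _) := by rw [hσ']
      rw [this]
      exact (congrArg (σ.φ a ≫ ·) (Category.id_comp _)).trans (Category.id_comp _).symm
  · refine ⟨_, (cech p).boundary n, 𝟙 _, cech_boundary_isUniversal p hn, ?_, isCover_id _⟩
    apply AugSemiSimplicial.MatchingFamily.ext
    · exact Category.id_comp _
    · funext m hm f
      exact Category.id_comp _

end Cech

/-! ### Compatible families over the diagram of elements -/

section Eval

variable {C : Type u} [Category.{v} C] {X : C} (U : AugSemiSimplicial.{w} C X)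

/-- The object of `El U` given by a generalized simplex. -/
def elOf {n : SemiSimplexCategoryᵒᵖ} (i : (U.U.obj n).I) : U.index.Elements := ⟨n, i⟩

/-- The morphism of `El U` over a face operator. -/
def elHom {n m : SemiSimplexCategoryᵒᵖ} (f : n ⟶ m) (i : (U.U.obj n).I) :
    elOf U i ⟶ elOf U ((U.U.map f).f i) := ⟨f, rfl⟩

lemma el_map_elHom {n m : SemiSimplexCategoryᵒᵖ} (f : n ⟶ m) (i : (U.U.obj n).I) :
    U.el.map (elHom U f i) = (U.U.map f).φ i :=
  Category.comp_id _

/-- The component of a semi-simplicial object at an object of `El U`. -/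
def elι (a : U.index.Elements) : (FormalCoproduct.incl C).obj (U.el.obj a) ⟶ U.U.obj a.1 :=
  componentι (U.U.obj a.1) a.2

lemma incl_map_el_map_comp {a b : U.index.Elements} (f : a ⟶ b) :
    (FormalCoproduct.incl C).map (U.el.map f) ≫ elι U b = elι U a ≫ U.U.map f.1 := by
  refine FormalCoproduct.hom_ext (funext fun _ => f.2.symm) fun _ => ?_
  refine (congrArg (· ≫ eqToHom _) (Category.comp_id _)).trans ?_
  refine ((Category.assoc _ _ _).trans (congrArg ((U.U.map f.1).φ a.2 ≫ ·) ?_)).trans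
    ((Category.comp_id _).trans (Category.id_comp _).symm)
  exact (eqToHom_trans (congrArg (U.U.obj b.1).obj f.2) _).trans (eqToHom_refl _ rfl)

/-- The map to `X` of the component at an object of `El U`. -/
def elAug (a : U.index.Elements) :
    (FormalCoproduct.incl C).obj (U.el.obj a) ⟶ (FormalCoproduct.incl C).obj X :=
  elι U a ≫ U.aug.app a.1

lemma incl_map_el_map_comp_elAug {a b : U.index.Elements} (f : a ⟶ b) :
    (FormalCoproduct.incl C).map (U.el.map f) ≫ elAug U b = elAug U a :=
  calc
    _ = ((FormalCoproduct.incl C).map (U.el.map f) ≫ elι U b) ≫ U.aug.app b.1 :=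
      (Category.assoc _ _ _).symm
    _ = (elι U a ≫ U.U.map f.1) ≫ U.aug.app b.1 := by rw [incl_map_el_map_comp]
    _ = elι U a ≫ U.U.map f.1 ≫ U.aug.app b.1 := Category.assoc _ _ _
    _ = elι U a ≫ U.aug.app a.1 :=
      congrArg (elι U a ≫ ·) ((U.aug.naturality f.1).trans (Category.comp_id _))

variable {U} in
/-- For a family of sections over the components of a semi-simplicial object that is compatible
with the face operators, evaluation commutes with the face operators. -/
lemma familyEval_map (P : Cᵒᵖ ⥤ Type t) (x : ∀ a : U.index.Elements, P.obj (op (U.el.obj a)))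
    (hx : ∀ {a b : U.index.Elements} (f : a ⟶ b), P.map (U.el.map f).op (x b) = x a)
    {n m : SemiSimplexCategoryᵒᵖ} (g : n ⟶ m) {Z : C}
    (q : (FormalCoproduct.incl C).obj Z ⟶ U.U.obj n) :
    familyEval P (A := U.U.obj m) (fun i => x ⟨m, i⟩) (q ≫ U.U.map g) =
      familyEval P (A := U.U.obj n) (fun i => x ⟨n, i⟩) q := by
  have h := hx (elHom U g (q.f ⟨⟩))
  rw [el_map_elHom] at h
  exact (ConcreteCategory.congr_hom (P.map_comp ((U.U.map g).φ (q.f ⟨⟩)).op (homComponent q).op) _).trans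
    (congrArg (P.map (homComponent q).op) h)

lemma cocone_app {D : Type u₂} [Category.{v₂} D] (K : C ⥤ D) (a : U.index.Elements) :
    (U.cocone K).ι.app a = K.map (inclPreimage (elAug U a)) :=
  congrArg K.map (Category.id_comp _).symm

/-- A generalized component of a cover of `X`, seen as a map to `X`. -/
lemma inclPreimage_comp {A : FormalCoproduct.{w} C} (p : A ⟶ (FormalCoproduct.incl C).obj X)
    {Z : C} (q : (FormalCoproduct.incl C).obj Z ⟶ A) :
    inclPreimage (q ≫ p) = homComponent q ≫ inclPreimage (componentι A (q.f ⟨⟩) ≫ p) :=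
  congrArg (homComponent q ≫ ·) (Category.id_comp _).symm

lemma incl_hom_ext {Z : C} {f g : (FormalCoproduct.incl.{w} C).obj Z ⟶ (FormalCoproduct.incl C).obj X}
    (h : inclPreimage f = inclPreimage g) : f = g :=
  FormalCoproduct.hom_ext (funext fun _ => rfl) fun _ => (Category.comp_id _).trans h

lemma familyEval_map_aug (P : Cᵒᵖ ⥤ Type t) {A : FormalCoproduct.{w} C}
    (p : A ⟶ (FormalCoproduct.incl C).obj X) {x : ∀ i, P.obj (op (A.obj i))} {y : P.obj (op X)}
    (h : ∀ i, P.map (inclPreimage (componentι A i ≫ p)).op y = x i) {Z : C}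
    (q : (FormalCoproduct.incl C).obj Z ⟶ A) :
    familyEval P x q = P.map (inclPreimage (q ≫ p)).op y := by
  rw [inclPreimage_comp, op_comp, P.map_comp, familyEval, ← h]
  rfl

end Eval

/-! ### From the hypercover condition to sheaves -/

section SheafOfTurns

variable {C : Type u} [Category.{v} C] [HasPullbacks C] {J : GrothendieckTopology C}
  {D : Type u₂} [Category.{v₂} D] {K : C ⥤ D}

/-- A matching family, evaluated at the vertex 0 of each simplex, is a cocone on the elements of the
Čech nerve. The map out of the colimit K X that it induces is the unique amalgamation. -/
lemma isSheafFor_of_isCover (hK : turnsHypercoversToColimits.{w} J D K) (d : D)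
    {X : C} {A : FormalCoproduct.{w} C} {p : A ⟶ (FormalCoproduct.incl C).obj X}
    (hp : IsCover J p) :
    Presieve.IsSheafFor (K.op ⋙ yoneda.obj d)
      (Presieve.ofArrows A.obj fun a => inclPreimage (componentι A a ≫ p)) := by
  rw [Presieve.isSheafFor_arrows_iff]
  intro x hx
  let P := K.op ⋙ yoneda.obj d
  obtain ⟨hc⟩ := hK X (cech p) hp.isHypercover_cech
  have hcompat {Z : C} (q q' : (FormalCoproduct.incl C).obj Z ⟶ A) (h : q ≫ p = q' ≫ p) :
      familyEval P x q = familyEval P x q' := by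
    refine hx _ _ _ _ _ ?_
    rw [← inclPreimage_comp, ← inclPreimage_comp, h]
  -- The choice of vertex is immaterial: by `hcompat` the value depends only on the composite to X.
  -- This gives naturality, although face operators need not preserve the vertex 0.
  let q (a : (cech p).index.Elements) : (FormalCoproduct.incl C).obj ((cech p).el.obj a) ⟶ A :=
    elι (cech p) a ≫ cechVertex p a.1.unop 0
  have hq (a) : q a ≫ p = elAug (cech p) a :=
    (Category.assoc _ _ _).trans (congrArg (elι (cech p) a ≫ ·) (cechVertex_comp p _ _))
  let s : Cocone ((cech p).el ⋙ K) :=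
    { pt := d
      ι :=
        { app := fun a => familyEval P x (q a)
          naturality := fun a b f => by
            refine ((familyEval_comp P x ((cech p).el.map f) (q b)).symm.trans ?_).trans
              (Category.comp_id _).symm
            refine hcompat _ _ ?_
            rw [Category.assoc, hq, hq, incl_map_el_map_comp_elAug] } }
  refine ⟨hc.desc s, fun i => ?_, fun y hy => ?_⟩
  · obtain ⟨σ, hσ⟩ := exists_cech_diagonal p
    obtain ⟨j, r, hr⟩ := exists_component (componentι A i ≫ σ)
    let a : (cech p).index.Elements := elOf (cech p) j
    have h := hc.fac s a
    rw [cocone_app] at h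
    have hrq : (FormalCoproduct.incl C).map r ≫ q a = componentι A i :=
      calc
        _ = ((FormalCoproduct.incl C).map r ≫ elι (cech p) a) ≫
            cechVertex p (SemiSimplexCategory.mk 0) 0 := (Category.assoc _ _ _).symm
        _ = componentι A i ≫ σ ≫ cechVertex p (SemiSimplexCategory.mk 0) 0 :=
          (congrArg (· ≫ cechVertex p (SemiSimplexCategory.mk 0) 0) hr).trans (Category.assoc _ _ _)
        _ = componentι A i := (congrArg (componentι A i ≫ ·) (hσ 0)).trans (Category.comp_id _)
    have hra : componentι A i ≫ p = (FormalCoproduct.incl C).map r ≫ elAug (cech p) a := by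
      rw [← hrq, ← hq]
      exact Category.assoc _ _ _
    calc
      _ = K.map (r ≫ inclPreimage (elAug (cech p) a)) ≫ hc.desc s := by
        rw [hra]; rfl
      _ = K.map r ≫ K.map (inclPreimage (elAug (cech p) a)) ≫ hc.desc s := by
        rw [K.map_comp]
        exact Category.assoc _ _ _
      _ = K.map r ≫ familyEval P x (q a) := congrArg (K.map r ≫ ·) h
      _ = familyEval P x ((FormalCoproduct.incl C).map r ≫ q a) :=
        (familyEval_comp P x r (q a)).symm
      _ = familyEval P x (componentι A i) := congrArg (familyEval P x) hrq
      _ = x i := familyEval_componentι P x i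
  · refine hc.hom_ext fun a => ?_
    rw [hc.fac, cocone_app]
    refine Eq.trans ?_ (familyEval_map_aug P p hy (q a)).symm
    rw [hq]
    rfl

/-- A functor that turns hypercovers to colimit cocones corepresents sheaves. -/
lemma isSheaf_of_turnsHypercoversToColimits (hJ : HasSmallCovers.{w} J)
    (hK : turnsHypercoversToColimits.{w} J D K) (d : D) :
    Presieve.IsSheaf J (K.op ⋙ yoneda.obj d) := by
  intro X S hS
  obtain ⟨A, p, hp, hpS⟩ := hJ X S hS
  -- It suffices that a smaller sieve and all its pullbacks satisfy the sheaf condition; the sieve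
  -- of a small cover is such, since its pullbacks are generated by the pulled-back small covers.
  refine Presieve.isSheafFor_subsieve _
    (S := Sieve.ofArrows A.obj fun a => inclPreimage (componentι A a ≫ p)) ?_ ?_
  · refine (Sieve.generate_le_iff _ _).2 ?_
    rintro _ _ ⟨a⟩
    have e : inclPreimage (componentι A a ≫ p) = p.φ a := Category.id_comp _
    rw [e]
    exact hpS a
  · intro Y f
    let π (a : A.I) := inclPreimage (componentι A a ≫ p)
    have hπ : Sieve.ofArrows A.obj π ∈ J X := (isCover_incl_iff p).1 hp
    let B : FormalCoproduct.{w} C := ⟨A.I, fun a => pullback (π a) f⟩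
    let q : B ⟶ (FormalCoproduct.incl C).obj Y := ⟨fun _ => ⟨⟩, fun a => pullback.snd (π a) f⟩
    have e : Sieve.ofArrows B.obj (fun a => inclPreimage (componentι B a ≫ q)) =
        (Sieve.ofArrows A.obj π).pullback f := by
      have : (fun a => inclPreimage (componentι B a ≫ q)) = fun a => pullback.snd (π a) f :=
        funext fun a => Category.id_comp _
      rw [this, Sieve.ofArrows, Sieve.ofArrows, ← Sieve.pullbackArrows_comm,
        Presieve.ofArrows_pullback]
    have hq : IsCover J q := by
      rw [isCover_incl_iff, e]
      exact J.pullback_stable f hπ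
    rw [← e]
    exact (Presieve.isSheafFor_iff_generate _).1 (isSheafFor_of_isCover hK d hq)

end SheafOfTurns

/-! ### Descent of sheaves along hypercovers -/

section Descent

variable {C : Type u} [Category.{v} C] {J : GrothendieckTopology C} {X : C}
  {U : AugSemiSimplicial.{w} C X}

/-- In dimension 0 there are no proper non-empty faces, so universality gives a section `h` of M ⟶
X. Lifting `h` locally through the matching map lifts the identity of X locally to the vertices. -/
lemma AugSemiSimplicial.IsHypercover.isCover_aug (hU : U.IsHypercover J) :
    IsCover J (U.aug.app (op (SemiSimplexCategory.mk 0))) := by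
  obtain ⟨M, t, p, ht, hp, hcov⟩ := hU 0
  let s : U.MatchingFamily 0 ((FormalCoproduct.incl C).obj X) :=
    { base := 𝟙 _
      face := fun m hm => absurd hm (Nat.not_lt_zero _)
      face_base := fun m hm => absurd hm (Nat.not_lt_zero _)
      face_face := fun m _ hm => absurd hm (Nat.not_lt_zero _) }
  obtain ⟨h, hh, -⟩ := ht _ s
  have hb : h ≫ t.base = 𝟙 _ := congrArg AugSemiSimplicial.MatchingFamily.base hh
  have hpb : p ≫ t.base = U.aug.app (op (SemiSimplexCategory.mk 0)) :=
    congrArg AugSemiSimplicial.MatchingFamily.base hp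
  rw [isCover_incl_iff]
  obtain ⟨S, hS, hl⟩ := hcov.local_lift h
  refine J.superset_covering (fun Y f hf => ?_) hS
  obtain ⟨q, hq⟩ := hl f hf
  obtain ⟨i, r, rfl⟩ := exists_component q
  refine ⟨_, r, _, ⟨i⟩, ?_⟩
  have e : (FormalCoproduct.incl C).map r ≫ componentι _ i ≫
      U.aug.app (op (SemiSimplexCategory.mk 0)) = (FormalCoproduct.incl C).map f := by
    rw [← hpb]
    have := congrArg (· ≫ t.base) hq
    simp only [Category.assoc, hb] at this
    exact this.trans (Category.comp_id _)
  exact congrArg inclPreimage e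

/-- Two vertices over the same point of `X` are locally joined by an edge. -/
lemma AugSemiSimplicial.IsHypercover.exists_edge (hU : U.IsHypercover J) {Z : C}
    (q : Fin 2 → ((FormalCoproduct.incl C).obj Z ⟶ U.simplices 0))
    (h : q 0 ≫ U.aug.app _ = q 1 ≫ U.aug.app _) :
    ∃ S ∈ J Z, ∀ ⦃Y : C⦄ (f : Y ⟶ Z), S f →
      ∃ r : (FormalCoproduct.incl C).obj Y ⟶ U.simplices 1, ∀ i : Fin 2,
        r ≫ U.U.map (vertexHom (SemiSimplexCategory.mk 1) i).op =
          (FormalCoproduct.incl C).map f ≫ q i := by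
  obtain ⟨M, t, p, ht, hp, hcov⟩ := hU 1
  have hq : ∀ i, q i ≫ U.aug.app _ = q 0 ≫ U.aug.app _ := by
    intro i
    fin_cases i
    exacts [rfl, h.symm]
  have hid : ∀ g : SemiSimplexCategory.mk 0 ⟶ SemiSimplexCategory.mk 0, g = 𝟙 _ := fun g =>
    SemiSimplexCategory.hom_ext (DFunLike.ext _ _ fun j => Subsingleton.elim (α := Fin 1) _ _)
  -- The proper non-empty faces of an edge are its two vertices, so a pair of vertices over the same
  -- point is a matching family.
  let s : U.MatchingFamily 1 ((FormalCoproduct.incl C).obj Z) :=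
    { base := q 0 ≫ U.aug.app _
      face := fun m => match m with
        | ⟨0⟩ => fun _ f => q (SemiSimplexCategory.homEquiv f 0)
        | ⟨_ + 1⟩ => fun hm => absurd hm (by simp)
      face_base := fun m => match m with
        | ⟨0⟩ => fun _ f => hq _
        | ⟨_ + 1⟩ => fun hm => absurd hm (by simp)
      face_face := fun m k => match m, k with
        | ⟨0⟩, ⟨0⟩ => fun hm hk f g => by
          obtain rfl := hid g
          dsimp only
          rw [Category.id_comp, op_id, U.U.map_id, Category.comp_id]
        | ⟨_ + 1⟩, _ => fun hm => absurd hm (by simp)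
        | _, ⟨_ + 1⟩ => fun _ hm => absurd hm (by simp) }
  obtain ⟨b, hb, -⟩ := ht _ s
  obtain ⟨S, hS, hl⟩ := hcov.local_lift b
  refine ⟨S, hS, fun Y f hf => ?_⟩
  obtain ⟨r, hr⟩ := hl f hf
  refine ⟨r, fun i => ?_⟩
  have h1 : U.U.map (vertexHom (SemiSimplexCategory.mk 1) i).op =
      p ≫ t.face (SemiSimplexCategory.mk 0) Nat.zero_lt_one (vertexHom _ i) :=
    (congrArg (fun m => AugSemiSimplicial.MatchingFamily.face m (SemiSimplexCategory.mk 0)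
      Nat.zero_lt_one (vertexHom _ i)) hp).symm
  have h2 : b ≫ t.face (SemiSimplexCategory.mk 0) Nat.zero_lt_one (vertexHom _ i) = q i :=
    (congrArg (fun m => AugSemiSimplicial.MatchingFamily.face m (SemiSimplexCategory.mk 0)
      Nat.zero_lt_one (vertexHom _ i)) hb).trans (congrArg q (homEquiv_vertexHom _ i 0))
  rw [h1, ← Category.assoc, hr, Category.assoc, h2]

/-- Sheaves satisfy descent with respect to hypercovers. -/
lemma AugSemiSimplicial.IsHypercover.existsUnique_of_isSheaf (hU : U.IsHypercover J)
    {P : Cᵒᵖ ⥤ Type t} (hP : Presieve.IsSheaf J P)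
    (x : ∀ a : U.index.Elements, P.obj (op (U.el.obj a)))
    (hx : ∀ {a b : U.index.Elements} (f : a ⟶ b), P.map (U.el.map f).op (x b) = x a) :
    ∃! y : P.obj (op X), ∀ a, P.map (inclPreimage (elAug U a)).op y = x a := by
  let x₀ (i : (U.simplices 0).I) : P.obj (op ((U.simplices 0).obj i)) := x ⟨_, i⟩
  let p : U.simplices 0 ⟶ (FormalCoproduct.incl C).obj X := U.aug.app _
  have hcompat {Z : C} (q q' : (FormalCoproduct.incl C).obj Z ⟶ U.simplices 0)
      (h : q ≫ p = q' ≫ p) : familyEval P x₀ q = familyEval P x₀ q' := by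
    obtain ⟨S, hS, hl⟩ := hU.exists_edge ![q, q'] h
    refine (hP S hS).isSeparatedFor.ext fun Y f hf => ?_
    obtain ⟨r, hr⟩ := hl f hf
    have e (i : Fin 2) := familyEval_map P x hx (vertexHom (SemiSimplexCategory.mk 1) i).op r
    have e' := (e 0).trans (e 1).symm
    rw [hr 0, hr 1] at e'
    rw [← familyEval_comp, ← familyEval_comp]
    exact e'
  have hsh := (Presieve.isSheafFor_iff_generate _).2 (hP _ ((isCover_incl_iff p).1 hU.isCover_aug))
  rw [Presieve.isSheafFor_arrows_iff] at hsh
  obtain ⟨y, hy, huniq⟩ := hsh x₀ fun i j Z gi gj e => by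
    have hi (i) (gi : Z ⟶ (U.simplices 0).obj i) : P.map gi.op (x₀ i) =
        familyEval P x₀ ((FormalCoproduct.incl C).map gi ≫ componentι _ i) := by
      rw [familyEval_comp, familyEval_componentι]
    rw [hi, hi]
    refine hcompat _ _ (incl_hom_ext ?_)
    rw [Category.assoc, Category.assoc]
    exact e
  refine ⟨y, fun a => ?_, fun y' hy' => huniq _ fun i => hy' (elOf U i)⟩
  -- The value at a simplex of any dimension is that at its vertex 0, so gluing over the vertices
  -- suffices.
  have e1 := familyEval_map P x hx (vertexHom a.1.unop 0).op (elι U a)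
  have e2 : familyEval P (A := U.U.obj a.1) (fun i => x ⟨a.1, i⟩) (elι U a) = x a :=
    familyEval_componentι P (A := U.U.obj a.1) (fun i => x ⟨a.1, i⟩) a.2
  rw [← e2, ← e1]
  refine Eq.trans ?_ (familyEval_map_aug P p hy (elι U a ≫ U.U.map _)).symm
  have e3 : (elι U a ≫ U.U.map (vertexHom a.1.unop 0).op) ≫ p = elAug U a :=
    (Category.assoc _ _ _).trans
      (congrArg (elι U a ≫ ·) ((U.aug.naturality _).trans (Category.comp_id _)))
  rw [e3]

end Descent

/-! ### The sheafified Yoneda embedding -/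

section Yoneda

variable {C : Type u} [Category.{v} C] (J : GrothendieckTopology C)

/-- Maps from a sheafified representable to a sheaf are sections of the sheaf. -/
noncomputable def sheafifiedYonedaEquiv {X : C} {F : Sheaf J (Type (max u v w))} :
    ((sheafifiedYoneda.{w} J).obj X ⟶ F) ≃ F.obj.obj (op X) :=
  ((sheafificationAdjunction J (Type (max u v w))).homEquiv _ _).trans uliftYonedaEquiv.{max u w}

lemma sheafifiedYonedaEquiv_comp {X : C} {F G : Sheaf J (Type (max u v w))}
    (f : (sheafifiedYoneda.{w} J).obj X ⟶ F) (g : F ⟶ G) :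
    sheafifiedYonedaEquiv J (f ≫ g) = g.hom.app (op X) (sheafifiedYonedaEquiv J f) := by
  exact (congrArg uliftYonedaEquiv.{max u w} (Adjunction.homEquiv_naturality_right
    (sheafificationAdjunction J (Type (max u v w))) (X := uliftYoneda.{max u w}.obj X) f g)).trans
    (uliftYonedaEquiv_comp _ _)

lemma sheafifiedYonedaEquiv_map {X Y : C} {F : Sheaf J (Type (max u v w))} (g : Y ⟶ X)
    (f : (sheafifiedYoneda.{w} J).obj X ⟶ F) :
    sheafifiedYonedaEquiv J ((sheafifiedYoneda.{w} J).map g ≫ f) =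
      F.obj.map g.op (sheafifiedYonedaEquiv J f) := by
  exact (congrArg uliftYonedaEquiv.{max u w} (Adjunction.homEquiv_naturality_left
    (sheafificationAdjunction J (Type (max u v w))) (uliftYoneda.{max u w}.map g) f)).trans
    (uliftYonedaEquiv_naturality.{max u w} (F := F.obj) ((sheafificationAdjunction J
      (Type (max u v w))).homEquiv (uliftYoneda.{max u w}.obj X) F f) g.op).symm

/-- The sheafified Yoneda embedding turns hypercovers to colimit cocones. -/
lemma turnsHypercoversToColimits_sheafifiedYoneda :
    turnsHypercoversToColimits.{w} J _ (sheafifiedYoneda.{w} J) := by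
  intro X U hU
  -- By Yoneda, a cocone with vertex a sheaf is a compatible family of its sections, which descent
  -- glues uniquely.
  have key (s : Cocone (U.el ⋙ sheafifiedYoneda.{w} J)) := by
    refine hU.existsUnique_of_isSheaf ((isSheaf_iff_isSheaf_of_type _ _).1 s.pt.property)
      (fun a => sheafifiedYonedaEquiv J (s.ι.app a)) fun {a b} f => ?_
    rw [← sheafifiedYonedaEquiv_map]
    exact congrArg _ (s.w f)
  refine ⟨⟨fun s => (sheafifiedYonedaEquiv J).symm (key s).exists.choose, fun s a => ?_,
    fun s m hm => ?_⟩⟩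
  · rw [cocone_app]
    apply (sheafifiedYonedaEquiv J).injective
    refine (sheafifiedYonedaEquiv_map J _ _).trans ?_
    rw [Equiv.apply_symm_apply]
    exact (key s).exists.choose_spec a
  · refine (Equiv.eq_symm_apply _).2 ((key s).unique (fun a => ?_) (key s).exists.choose_spec)
    rw [← hm a, cocone_app]
    exact (sheafifiedYonedaEquiv_map J _ _).symm

end Yoneda

/-! ### Small sheaves and induction on colimits -/

section Small

variable {C : Type u} [Category.{v} C] (J : GrothendieckTopology C)

lemma turnsHypercoversToColimits_smallYoneda :
    turnsHypercoversToColimits.{w} J _ (smallYoneda.{w} J) := by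
  intro X U hU
  obtain ⟨hc⟩ := turnsHypercoversToColimits_sheafifiedYoneda.{w} J X U hU
  exact ⟨isColimitOfReflects (isSmallSheaf.{w} J).ι (c := U.cocone (smallYoneda.{w} J)) hc⟩

lemma turnsHypercoversToColimits_comp_of_cocontinuous {D : Type u₂} [Category.{v₂} D]
    (L : SmallSheaf.{w} J ⥤ D) (hL : cocontinuous.{w} J D L) :
    turnsHypercoversToColimits.{w} J D (smallYoneda.{w} J ⋙ L) := by
  intro X U hU
  obtain ⟨hc⟩ := turnsHypercoversToColimits_smallYoneda.{w} J X U hU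
  have : PreservesColimitsOfSize.{w, w} L := hL
  -- The category of elements has its objects in `Type w` but its morphisms in `Type`.
  have : PreservesColimitsOfSize.{0, w} L := preservesColimitsOfSize_of_univLE.{w, w, 0, w} L
  exact ⟨isColimitOfPreserves L hc⟩

instance (I : Type w) [Category.{w} I] : (isSmallSheaf.{w} J).IsClosedUnderColimitsOfShape I :=
  inferInstanceAs (((sheafifiedYoneda.{w} J).essImage.colimitsClosure
    (fun A : Cat.{w, w} => A)).IsClosedUnderColimitsOfShape (Cat.of I))

/-- A property of small sheaves that is closed under small colimits and holds for the
sheafified representables holds for all small sheaves. -/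
lemma SmallSheaf.induction (Q : ObjectProperty (SmallSheaf.{w} J)) [Q.IsClosedUnderIsomorphisms]
    (hQ : ∀ (I : Type w) [Category.{w} I], Q.IsClosedUnderColimitsOfShape I)
    (hy : ∀ X, Q ((smallYoneda.{w} J).obj X)) (F : SmallSheaf.{w} J) : Q F := by
  obtain ⟨F, hF⟩ := F
  induction hF with
  | of_mem F hF' =>
    obtain ⟨X, ⟨e⟩⟩ := hF'
    exact Q.prop_of_iso ((isSmallSheaf.{w} J).isoMk e) (hy X)
  | of_isoClosure e hF h =>
    exact Q.prop_of_iso ((isSmallSheaf.{w} J).isoMk e) h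
  | @of_colimitPresentation F A pres hd h =>
    have := hQ A
    let G : A ⥤ SmallSheaf.{w} J := (isSmallSheaf.{w} J).lift pres.diag hd
    let c : Cocone G :=
      { pt := ⟨F, .of_colimitPresentation pres hd⟩
        ι := { app := fun j => ObjectProperty.homMk (pres.ι.app j)
               naturality := fun i j f => by
                ext1
                exact pres.ι.naturality f } }
    have hc : IsColimit c := isColimitOfReflects (isSmallSheaf.{w} J).ι pres.isColimit
    exact Q.prop_of_isColimit hc h

end Small

/-! ### Change of universe for sheaves -/

section Ulift

variable {C : Type u} [Category.{v} C] (J : GrothendieckTopology C)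

/-- Sheafification is assembled from limits of matching-family diagrams and colimits over covers,
both of which the lift preserves. -/
lemma preservesSheafification_uliftFunctor :
    J.PreservesSheafification (uliftFunctor.{v₂, max u v w}) := by
  have : ∀ X, PreservesColimitsOfShape (J.Cover X)ᵒᵖ (uliftFunctor.{v₂, max u v w}) :=
    inferInstance
  have : PreservesLimitsOfSize.{max u v, max u v} (uliftFunctor.{v₂, max u v w}) := inferInstance
  have : ∀ (X : C) (W : J.Cover X) (P : Cᵒᵖ ⥤ Type (max u v w)),
    PreservesLimit (W.index P).multicospan (uliftFunctor.{v₂, max u v w}) := inferInstance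
  have : ∀ K : MulticospanShape.{max v u, max v u},
    HasLimitsOfShape (WalkingMulticospan K) (Type (max u v w)) := inferInstance
  have : ∀ K : MulticospanShape.{max v u, max v u},
    HasLimitsOfShape (WalkingMulticospan K) (Type (max (max u v w) v₂)) := inferInstance
  have : ∀ X : C, HasColimitsOfShape (J.Cover X)ᵒᵖ (Type (max u v w)) := inferInstance
  have : ∀ X : C, HasColimitsOfShape (J.Cover X)ᵒᵖ (Type (max (max u v w) v₂)) := inferInstance
  have : ∀ X : C, PreservesColimitsOfShape (J.Cover X)ᵒᵖ (forget (Type (max u v w))) :=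
    inferInstance
  have : ∀ X : C, PreservesColimitsOfShape (J.Cover X)ᵒᵖ (forget (Type (max (max u v w) v₂))) :=
    inferInstance
  have : PreservesLimitsOfSize.{max v u, max v u} (forget (Type (max u v w))) := inferInstance
  have : PreservesLimitsOfSize.{max v u, max v u} (forget (Type (max (max u v w) v₂))) :=
    inferInstance
  exact GrothendieckTopology.instPreservesSheafification J (uliftFunctor.{v₂, max u v w})

attribute [local instance 2000] preservesSheafification_uliftFunctor

/-- The change of universes for sheaves. -/
abbrev uliftSheaf : Sheaf J (Type (max u v w)) ⥤ Sheaf J (Type (max (max u v w) v₂)) :=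
  sheafCompose J uliftFunctor.{v₂, max u v w}

/-- Colimits of sheaves are sheafified colimits of presheaves, and the lift commutes with both
operations. -/
lemma preservesColimitsOfShape_uliftSheaf (I : Type w) [Category.{w} I] :
    PreservesColimitsOfShape I (uliftSheaf.{w, v, u, v₂} J) := by
  let a := presheafToSheaf J (Type (max u v w))
  let a' := presheafToSheaf J (Type (max (max u v w) v₂))
  let W := (Functor.whiskeringRight Cᵒᵖ _ _).obj uliftFunctor.{v₂, max u v w}
  let e : W ⋙ a' ≅ a ⋙ uliftSheaf.{w, v, u, v₂} J :=
    sheafComposeNatIso J _ (sheafificationAdjunction J _) (sheafificationAdjunction J _)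
  have : PreservesColimitsOfShape I uliftFunctor.{v₂, max u v w} := inferInstance
  have : PreservesColimitsOfShape I W := inferInstance
  have : PreservesColimitsOfShape I a' := inferInstance
  have : PreservesColimitsOfShape I a := inferInstance
  have : PreservesColimitsOfShape I (a ⋙ uliftSheaf.{w, v, u, v₂} J) :=
    preservesColimitsOfShape_of_natIso e
  refine ⟨fun {F} => ?_⟩
  let G := F ⋙ sheafToPresheaf J _
  have : PreservesColimit (G ⋙ a) (uliftSheaf.{w, v, u, v₂} J) :=
    preservesColimit_of_preserves_colimit_cocone
      (isColimitOfPreserves a (colimit.isColimit G))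
      (isColimitOfPreserves (a ⋙ uliftSheaf.{w, v, u, v₂} J) (colimit.isColimit G))
  let i : G ⋙ a ≅ F := Functor.isoWhiskerLeft F (sheafificationNatIso J (Type (max u v w))).symm
  exact preservesColimit_of_iso_diagram _ i

/-- Small sheaves, as sheaves in a larger universe. -/
abbrev uliftSmallSheaf : SmallSheaf.{w} J ⥤ Sheaf J (Type (max (max u v w) v₂)) :=
  (isSmallSheaf.{w} J).ι ⋙ uliftSheaf.{w, v, u, v₂} J

lemma preservesColimitsOfShape_uliftSmallSheaf (I : Type w) [Category.{w} I] :
    PreservesColimitsOfShape I (uliftSmallSheaf.{w, v, u, v₂} J) :=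
  haveI := preservesColimitsOfShape_uliftSheaf.{w, v, u, v₂} J I
  comp_preservesColimitsOfShape _ _

end Ulift

/-! ### Cocones as maps into hom-sheaves -/

section HomSheaf

variable {C : Type u} [Category.{v} C] (J : GrothendieckTopology C) {D : Type u₂} [Category.{v₂} D]

/-- Maps from a sheafified representable to a small sheaf are sections of the sheaf. -/
noncomputable def smallYonedaEquiv {X : C} {F : SmallSheaf.{w} J} :
    ((smallYoneda.{w} J).obj X ⟶ F) ≃ F.obj.obj.obj (op X) where
  toFun f := sheafifiedYonedaEquiv J f.hom
  invFun x := ObjectProperty.homMk ((sheafifiedYonedaEquiv J).symm x)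
  left_inv f := by
    ext1
    exact Equiv.symm_apply_apply _ _
  right_inv x := Equiv.apply_symm_apply _ _

lemma smallYonedaEquiv_comp {X : C} {F G : SmallSheaf.{w} J}
    (f : (smallYoneda.{w} J).obj X ⟶ F) (g : F ⟶ G) :
    smallYonedaEquiv J (f ≫ g) = g.hom.hom.app (op X) (smallYonedaEquiv J f) :=
  sheafifiedYonedaEquiv_comp J _ _

lemma smallYonedaEquiv_map {X Y : C} {F : SmallSheaf.{w} J} (g : Y ⟶ X)
    (f : (smallYoneda.{w} J).obj X ⟶ F) :
    smallYonedaEquiv J ((smallYoneda.{w} J).map g ≫ f) =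
      F.obj.obj.map g.op (smallYonedaEquiv J f) :=
  sheafifiedYonedaEquiv_map J _ _

variable {J} {K : C ⥤ D} (hK : ∀ d, Presieve.IsSheaf J (K.op ⋙ yoneda.obj d))

/-- The sheaves `X ↦ (K X ⟶ d)`, in a larger universe. -/
def homSheaf : D ⥤ Sheaf J (Type (max (max u v w) v₂)) where
  obj d := ⟨(K.op ⋙ yoneda.obj d) ⋙ uliftFunctor.{max u v w, v₂},
    (isSheaf_iff_isSheaf_of_type _ _).2 (Presieve.isSheaf_comp_uliftFunctor J (hK d))⟩
  map g := ⟨Functor.whiskerRight (Functor.whiskerLeft K.op (yoneda.map g)) uliftFunctor⟩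
  map_id d := by
    ext X x
    exact congrArg ULift.up (Category.comp_id _)
  map_comp f g := by
    ext X x
    exact congrArg ULift.up (Category.assoc _ _ _).symm

/-- Maps from a small sheaf `F` to the sheaf `X ↦ (K X ⟶ d)` are cocones over the diagram that
defines the value at `F` of the left Kan extension of `K`. -/
noncomputable def coconeEquiv (F : SmallSheaf.{w} J) (d : D) :
    ((uliftSmallSheaf.{w, v, u, v₂} J).obj F ⟶ (homSheaf.{w} hK).obj d) ≃
      (CostructuredArrow.proj (smallYoneda.{w} J) F ⋙ K ⟶ (Functor.const _).obj d) where
  -- An object of the comma category is an X with a section of F over X, so a cocone on it is a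
  -- natural transformation from F to D(K-, d).
  toFun τ :=
    { app := fun g => (τ.hom.app (op g.left) ⟨smallYonedaEquiv J g.hom⟩).down
      naturality := fun g g' f => by
        have h := ConcreteCategory.congr_hom (τ.hom.naturality f.left.op)
          ⟨smallYonedaEquiv J g'.hom⟩
        have e : F.obj.obj.map f.left.op (smallYonedaEquiv J g'.hom) =
            smallYonedaEquiv J g.hom := by
          rw [← smallYonedaEquiv_map, CostructuredArrow.w f]
        refine (congrArg ULift.down h).symm.trans (Eq.trans ?_ (Category.comp_id _).symm)
        exact congrArg (fun y => (τ.hom.app (op g.left) ⟨y⟩).down) e }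
  invFun s := ⟨
    { app := fun X => ↾fun x =>
        ⟨s.app (CostructuredArrow.mk ((smallYonedaEquiv J (X := X.unop)).symm x.down))⟩
      naturality := fun X Y f => by
        ext x
        let g := (smallYonedaEquiv J (X := X.unop)).symm x.down
        have e : (smallYonedaEquiv J (X := Y.unop)).symm (F.obj.obj.map f x.down) =
            (smallYoneda.{w} J).map f.unop ≫ g := by
          rw [Equiv.symm_apply_eq, smallYonedaEquiv_map, Equiv.apply_symm_apply]
          rfl
        have h := s.naturality (CostructuredArrow.homMk f.unop rfl :
          CostructuredArrow.mk ((smallYoneda.{w} J).map f.unop ≫ g) ⟶ CostructuredArrow.mk g)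
        apply ULift.ext
        refine Eq.trans ?_ (h.trans (Category.comp_id _)).symm
        let φ (y : (smallYoneda.{w} J).obj Y.unop ⟶ F) : K.obj Y.unop ⟶ d :=
          s.app (CostructuredArrow.mk y)
        exact congrArg φ e }⟩
  left_inv τ := by
    ext X x
    apply ULift.ext
    exact congrArg (fun y => (τ.hom.app X ⟨y⟩).down) (Equiv.apply_symm_apply _ _)
  right_inv s := by
    ext g
    let φ (y : (smallYoneda.{w} J).obj g.left ⟶ F) : K.obj g.left ⟶ d :=
      s.app (CostructuredArrow.mk y)
    exact congrArg φ (Equiv.symm_apply_apply _ _)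

lemma coconeEquiv_comp {F : SmallSheaf.{w} J} {d d' : D}
    (τ : (uliftSmallSheaf.{w, v, u, v₂} J).obj F ⟶ (homSheaf.{w} hK).obj d) (f : d ⟶ d') :
    coconeEquiv hK F d' (τ ≫ (homSheaf.{w} hK).map f) =
      coconeEquiv hK F d τ ≫ (Functor.const _).map f :=
  rfl

lemma coconeEquiv_map {F G : SmallSheaf.{w} J} {d : D} (φ : F ⟶ G)
    (τ : (uliftSmallSheaf.{w, v, u, v₂} J).obj G ⟶ (homSheaf.{w} hK).obj d)
    (g : CostructuredArrow (smallYoneda.{w} J) F) :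
    (coconeEquiv hK F d ((uliftSmallSheaf.{w, v, u, v₂} J).map φ ≫ τ)).app g =
      (coconeEquiv hK G d τ).app ((CostructuredArrow.map φ).obj g) :=
  congrArg (fun y => (τ.hom.app (op g.left) ⟨y⟩).down) (smallYonedaEquiv_comp J g.hom φ).symm

end HomSheaf

/-! ### Relative adjoints and colimits -/

section RelativeAdjoint

variable {A D H : Type*} [Category* A] [Category* D] [Category* H]

/-- A functor that is left adjoint to a functor `R` relative to `V` preserves the colimits that
`V` preserves. -/
lemma preservesColimitsOfShape_of_relativeAdjoint (L : A ⥤ D) (V : A ⥤ H) (R : D ⥤ H)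
    (e : ∀ F d, (L.obj F ⟶ d) ≃ (V.obj F ⟶ R.obj d))
    (he : ∀ {F G : A} {d : D} (φ : F ⟶ G) (f : L.obj G ⟶ d),
      e F d (L.map φ ≫ f) = V.map φ ≫ e G d f)
    (I : Type*) [Category* I] [PreservesColimitsOfShape I V] : PreservesColimitsOfShape I L where
  preservesColimit {G} :=
    { preserves := fun {c} hc => by
        have hV := isColimitOfPreserves V hc
        have key (s : Cocone (G ⋙ L)) : ∃! f : L.obj c.pt ⟶ s.pt,
            ∀ i, L.map (c.ι.app i) ≫ f = s.ι.app i := by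
          let s' : Cocone (G ⋙ V) :=
            { pt := R.obj s.pt
              ι :=
                { app := fun i => e _ _ (s.ι.app i)
                  naturality := fun i j φ => by
                    refine (he (G.map φ) (s.ι.app j)).symm.trans
                      ((congrArg (e _ _) (s.w φ)).trans (Category.comp_id _).symm) } }
          refine ⟨(e _ _).symm (hV.desc s'), fun i => ?_, fun f hf => ?_⟩
          · apply (e _ _).injective
            refine (he _ _).trans (Eq.trans ?_ (hV.fac s' i))
            exact congrArg (V.map (c.ι.app i) ≫ ·) (Equiv.apply_symm_apply _ _)
          · refine (Equiv.eq_symm_apply _).2 (hV.hom_ext fun i => ?_)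
            refine Eq.trans ?_ (hV.fac s' i).symm
            exact (he _ _).symm.trans (congrArg (e _ _) (hf i))
        exact ⟨⟨fun s => (key s).exists.choose, fun s => (key s).exists.choose_spec,
          fun s m hm => (key s).unique hm (key s).exists.choose_spec⟩⟩ }

end RelativeAdjoint

/-! ### Existence and cocontinuity of the Kan extension -/

section Extension

variable {C : Type u} [Category.{v} C] {J : GrothendieckTopology C} {D : Type u₂} [Category.{v₂} D]

/-- The lifted sheafification unit is still inverted by maps into sheaves, so the Yoneda lemma for
the lifted representable presheaf carries over, even for sheaves G that come from no smaller
universe. -/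
lemma bijective_evaluation (X : C) (G : Sheaf J (Type (max (max u v w) v₂))) :
    Function.Bijective
      (fun τ : (uliftSmallSheaf.{w, v, u, v₂} J).obj ((smallYoneda.{w} J).obj X) ⟶ G =>
        τ.hom.app (op X) ⟨smallYonedaEquiv J (𝟙 _)⟩) := by
  have := preservesSheafification_uliftFunctor.{w, v, u, v₂} J
  let y : Cᵒᵖ ⥤ Type (max u v w) := uliftYoneda.{max u w}.obj X
  let η := Functor.whiskerRight (toSheafify J y) uliftFunctor.{v₂, max u v w}
  have hη : J.W η :=
    J.W_of_preservesSheafification (uliftFunctor.{v₂, max u v w}) _ (J.W_toSheafify y)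
  have h1 := hη G.obj G.property
  have e1 : smallYonedaEquiv J (𝟙 ((smallYoneda.{w} J).obj X)) =
      (toSheafify J y).app (op X) ⟨𝟙 X⟩ := by
    change uliftYonedaEquiv.{max u w} ((sheafificationAdjunction J _).homEquiv _ _ (𝟙 _)) = _
    rw [Adjunction.homEquiv_id]
    rfl
  have h2 : Function.Bijective (fun τ : y ⋙ uliftFunctor.{v₂, max u v w} ⟶ G.obj =>
      τ.app (op X) ⟨⟨𝟙 X⟩⟩) := by
    have hτ (τ : y ⋙ uliftFunctor.{v₂, max u v w} ⟶ G.obj) (Y : Cᵒᵖ) (f : Y.unop ⟶ X) :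
        τ.app Y ⟨⟨f⟩⟩ = G.obj.map f.op (τ.app (op X) ⟨⟨𝟙 X⟩⟩) := by
      refine Eq.trans ?_ (ConcreteCategory.congr_hom (τ.naturality f.op) ⟨⟨𝟙 X⟩⟩)
      exact congrArg (fun f : Y.unop ⟶ X => τ.app Y ⟨⟨f⟩⟩) (Category.comp_id f).symm
    constructor
    · intro τ τ' h
      ext Y ⟨⟨f⟩⟩
      exact (hτ τ Y f).trans ((congrArg (G.obj.map f.op) h).trans (hτ τ' Y f).symm)
    · intro x
      refine ⟨{ app := fun Y => ↾fun f => G.obj.map f.down.down.op x, naturality := ?_ }, ?_⟩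
      · intro Y Z g
        ext ⟨⟨f⟩⟩
        exact ConcreteCategory.congr_hom (G.obj.map_comp f.op g) x
      · exact ConcreteCategory.congr_hom (G.obj.map_id (op X)) x
  have h3 : Function.Bijective
      (fun τ : (uliftSmallSheaf.{w, v, u, v₂} J).obj ((smallYoneda.{w} J).obj X) ⟶ G => τ.hom) :=
    ⟨fun τ τ' h => by ext1; exact h, fun τ => ⟨⟨τ⟩, rfl⟩⟩
  convert (h2.comp h1).comp h3 using 1
  funext τ
  rw [e1]
  rfl

variable {K : C ⥤ D} (hK : ∀ d, Presieve.IsSheaf J (K.op ⋙ yoneda.obj d))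

/-- Maps from a sheafified representable to the sheaf `X ↦ (K X ⟶ d)`. -/
noncomputable def homSheafEvaluation (X : C) (d : D) :
    ((uliftSmallSheaf.{w, v, u, v₂} J).obj ((smallYoneda.{w} J).obj X) ⟶
      (homSheaf.{w} hK).obj d) ≃ (K.obj X ⟶ d) :=
  (Equiv.ofBijective _
    (bijective_evaluation.{w, v, u, v₂} X ((homSheaf.{w} hK).obj d))).trans Equiv.ulift

lemma homSheafEvaluation_comp (X : C) {d d' : D}
    (τ : (uliftSmallSheaf.{w, v, u, v₂} J).obj ((smallYoneda.{w} J).obj X) ⟶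
      (homSheaf.{w} hK).obj d) (f : d ⟶ d') :
    homSheafEvaluation hK X d' (τ ≫ (homSheaf.{w} hK).map f) = homSheafEvaluation hK X d τ ≫ f :=
  rfl

lemma coconeEquiv_app_id (X : C) {d : D}
    (τ : (uliftSmallSheaf.{w, v, u, v₂} J).obj ((smallYoneda.{w} J).obj X) ⟶
      (homSheaf.{w} hK).obj d) :
    (coconeEquiv hK _ d τ).app (CostructuredArrow.mk (𝟙 ((smallYoneda.{w} J).obj X))) =
      homSheafEvaluation hK X d τ :=
  rfl

section

variable (E : (smallYoneda.{w} J).LeftExtension K) (hE : E.IsPointwiseLeftKanExtension)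

include hK hE

/-- Maps from the extension at a representable to d are maps from it to D(K-, d), hence maps K X ⟶
d. Evaluating at the identity object of the comma category shows that this bijection is
precomposition with the unit. -/
lemma isIso_hom_of_isPointwiseLeftKanExtension : IsIso E.hom := by
  have (X : C) : IsIso (E.hom.app X) := by
    refine isIso_of_coyoneda_map_bijective _ fun d => ?_
    let e : (E.right.obj ((smallYoneda.{w} J).obj X) ⟶ d) ≃ (K.obj X ⟶ d) :=
      ((hE ((smallYoneda.{w} J).obj X)).homEquiv (W := d)).trans
        ((coconeEquiv hK _ d).symm.trans (homSheafEvaluation hK X d))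
    have he (f) : e f = E.hom.app X ≫ f := by
      refine (coconeEquiv_app_id hK X _).symm.trans
        ((congrArg (fun s => NatTrans.app s (CostructuredArrow.mk (𝟙 _)))
          (Equiv.apply_symm_apply (coconeEquiv hK _ d) ((hE _).homEquiv f))).trans ?_)
      change (E.hom.app X ≫ E.right.map (𝟙 _)) ≫ f = _
      rw [E.right.map_id]
      exact congrArg (· ≫ f) (Category.comp_id _)
    exact (funext he : ⇑e = _) ▸ e.bijective
  exact NatIso.isIso_of_isIso_app E.hom

/-- The extension is left adjoint to `homSheaf hK` relative to the change of universe, which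
preserves small colimits. -/
lemma preservesColimits_of_isPointwiseLeftKanExtension :
    PreservesColimitsOfSize.{w, w} E.right where
  preservesColimitsOfShape {I} _ := by
    have := preservesColimitsOfShape_uliftSmallSheaf.{w, v, u, v₂} J I
    refine preservesColimitsOfShape_of_relativeAdjoint E.right (uliftSmallSheaf.{w, v, u, v₂} J)
      (homSheaf.{w} hK) (fun F d => (hE F).homEquiv.trans (coconeEquiv hK F d).symm) ?_ I
    intro F G d φ f
    apply (coconeEquiv hK F d).injective
    ext g
    rw [coconeEquiv_map]
    refine (congrArg (fun s => NatTrans.app s g) (Equiv.apply_symm_apply (coconeEquiv hK F d)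
      ((hE F).homEquiv (E.right.map φ ≫ f)))).trans (Eq.trans ?_
        (congrArg (fun s => NatTrans.app s ((CostructuredArrow.map φ).obj g))
          (Equiv.apply_symm_apply (coconeEquiv hK G d) ((hE G).homEquiv f))).symm)
    change (E.hom.app g.left ≫ E.right.map g.hom) ≫ E.right.map φ ≫ f =
      (E.hom.app g.left ≫ E.right.map (g.hom ≫ φ)) ≫ f
    rw [E.right.map_comp]
    simp only [Category.assoc]

end

/-- Induction on small sheaves: the partial left adjoint is defined at representables, with value K
X, and small colimits in D extend it along small colimits. -/
lemma leftAdjointObjIsDefined_uliftSmallSheaf [HasColimitsOfSize.{w, w} D] (F : SmallSheaf.{w} J) :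
    (homSheaf.{w} hK).leftAdjointObjIsDefined ((uliftSmallSheaf.{w, v, u, v₂} J).obj F) := by
  let R := homSheaf.{w} hK
  let V := uliftSmallSheaf.{w, v, u, v₂} J
  let Q : ObjectProperty (SmallSheaf.{w} J) := fun F => R.leftAdjointObjIsDefined (V.obj F)
  have : Q.IsClosedUnderIsomorphisms :=
    ⟨fun {F G} e hF => by
      obtain ⟨Y, ⟨r⟩⟩ := hF
      exact ⟨Y, ⟨r.ofIso (Functor.isoWhiskerLeft R (coyoneda.mapIso (V.mapIso e.symm).op))⟩⟩⟩
  refine SmallSheaf.induction J Q (fun I _ => ⟨?_⟩) (fun X => ?_) F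
  · rintro F ⟨p⟩
    have := preservesColimitsOfShape_uliftSmallSheaf.{w, v, u, v₂} J I
    exact Functor.leftAdjointObjIsDefined_of_isColimit (isColimitOfPreserves V p.isColimit)
      p.prop_diag_obj
  · exact ⟨K.obj X, ⟨
      { homEquiv := fun {d} => (homSheafEvaluation hK X d).symm
        homEquiv_comp := fun {d d'} g f => by
          rw [Equiv.symm_apply_eq]
          refine Eq.trans ?_ (homSheafEvaluation_comp hK X _ g).symm
          rw [Equiv.apply_symm_apply] }⟩⟩

include hK in
-- An object corepresenting cocones is a colimit, so the possibly large comma category does no harm.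
lemma hasPointwiseLeftKanExtension [HasColimitsOfSize.{w, w} D] :
    (smallYoneda.{w} J).HasPointwiseLeftKanExtension K := by
  intro F
  obtain ⟨Y, ⟨r⟩⟩ := leftAdjointObjIsDefined_uliftSmallSheaf hK F
  have r' : (CostructuredArrow.proj (smallYoneda.{w} J) F ⋙ K).cocones.CorepresentableBy Y :=
    { homEquiv := fun {d} => r.homEquiv.trans (coconeEquiv hK F d)
      homEquiv_comp := fun {d d'} g f =>
        (congrArg (coconeEquiv hK F d') (r.homEquiv_comp g f)).trans (coconeEquiv_comp hK _ g) }
  exact ⟨⟨_, IsColimit.ofCorepresentableBy r'⟩⟩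

end Extension

/-! ### Invertibility of unit and counit -/

section Equivalence

variable {C : Type u} [Category.{v} C] (J : GrothendieckTopology C) {D : Type u₂} [Category.{v₂} D]

/-- A natural transformation between cocontinuous functors on small sheaves is invertible as soon
as it is invertible on the sheafified representables. -/
lemma isIso_of_isIso_app_smallYoneda {L L' : SmallSheaf.{w} J ⥤ D}
    (hL : cocontinuous.{w} J D L) (hL' : cocontinuous.{w} J D L') (τ : L ⟶ L')
    (hτ : ∀ X, IsIso (τ.app ((smallYoneda.{w} J).obj X))) : IsIso τ := by
  have : PreservesColimitsOfSize.{w, w} L := hL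
  have : PreservesColimitsOfSize.{w, w} L' := hL'
  let Q : ObjectProperty (SmallSheaf.{w} J) := fun F => IsIso (τ.app F)
  have : Q.IsClosedUnderIsomorphisms := ⟨fun e h => (NatTrans.isIso_app_iff_of_iso τ e).1 h⟩
  have hQ : ∀ F, Q F := SmallSheaf.induction J Q (fun I _ => ⟨by
    rintro F ⟨p⟩
    have (i : I) : IsIso ((Functor.whiskerLeft p.diag τ).app i) := p.prop_diag_obj i
    have : IsIso (Functor.whiskerLeft p.diag τ) := NatIso.isIso_of_isIso_app _
    let e : L.obj F ≅ L'.obj F := IsColimit.coconePointsIsoOfNatIso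
      (isColimitOfPreserves L p.isColimit) (isColimitOfPreserves L' p.isColimit)
      (asIso (Functor.whiskerLeft p.diag τ))
    have he : τ.app F = e.hom := by
      refine (isColimitOfPreserves L p.isColimit).hom_ext fun i => ?_
      exact (τ.naturality (p.ι.app i)).trans (IsColimit.comp_coconePointsIsoOfNatIso_hom
        (isColimitOfPreserves L p.isColimit) (isColimitOfPreserves L' p.isColimit)
        (asIso (Functor.whiskerLeft p.diag τ)) i).symm
    change IsIso (τ.app F)
    rw [he]
    infer_instance⟩) hτ
  have (F : SmallSheaf.{w} J) : IsIso (τ.app F) := hQ F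
  exact NatIso.isIso_of_isIso_app τ

end Equivalence

end LargeSite

theorem mainTheorem6 {C : Type u} [Category.{v} C] [HasPullbacks C]
    (J : GrothendieckTopology C) (hJ : LargeSite.HasSmallCovers.{w} J)
    (D : Type u₂) [Category.{v₂} D] [HasColimitsOfSize.{w, w} D] :
    ∃ h : ∀ L : LargeSite.SmallSheaf.{w} J ⥤ D, LargeSite.cocontinuous.{w} J D L →
        LargeSite.turnsHypercoversToColimits.{w} J D (LargeSite.smallYoneda.{w} J ⋙ L),
      ∃ (lan : (LargeSite.turnsHypercoversToColimits.{w} J D).FullSubcategory ⥤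
            (LargeSite.cocontinuous.{w} J D).FullSubcategory)
        (adj : lan ⊣ LargeSite.restriction.{w} J D h),
        IsIso adj.unit ∧ IsIso adj.counit ∧
        ∀ K : (LargeSite.turnsHypercoversToColimits.{w} J D).FullSubcategory,
          Nonempty (Functor.LeftExtension.IsPointwiseLeftKanExtension
            (Functor.LeftExtension.mk (lan.obj K).obj
              ((adj.unit.app K).hom :
                K.obj ⟶ LargeSite.smallYoneda.{w} J ⋙ (lan.obj K).obj))) := by
  let y := LargeSite.smallYoneda.{w} J
  have hsheaf (K : (LargeSite.turnsHypercoversToColimits.{w} J D).FullSubcategory) (d : D) :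
      Presieve.IsSheaf J (K.obj.op ⋙ yoneda.obj d) :=
    LargeSite.isSheaf_of_turnsHypercoversToColimits hJ K.property d
  have hlan (K : (LargeSite.turnsHypercoversToColimits.{w} J D).FullSubcategory) :
      y.HasPointwiseLeftKanExtension K.obj := LargeSite.hasPointwiseLeftKanExtension (hsheaf K)
  let lanObj (K : (LargeSite.turnsHypercoversToColimits.{w} J D).FullSubcategory) :
      (LargeSite.cocontinuous.{w} J D).FullSubcategory :=
    ⟨y.pointwiseLeftKanExtension K.obj,
      LargeSite.preservesColimits_of_isPointwiseLeftKanExtension (hsheaf K) _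
        (y.pointwiseLeftKanExtensionIsPointwiseLeftKanExtension K.obj)⟩
  let unit (K : (LargeSite.turnsHypercoversToColimits.{w} J D).FullSubcategory) :=
    y.pointwiseLeftKanExtensionUnit K.obj
  have hunit (K) : IsIso (unit K) := LargeSite.isIso_hom_of_isPointwiseLeftKanExtension (hsheaf K)
      _ (y.pointwiseLeftKanExtensionIsPointwiseLeftKanExtension K.obj)
  let h := LargeSite.turnsHypercoversToColimits_comp_of_cocontinuous.{w} J (D := D)
  -- The universal property of the Kan extension, transported to the two full subcategories.
  let e (K) (L : (LargeSite.cocontinuous.{w} J D).FullSubcategory) :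
      (lanObj K ⟶ L) ≃ (K ⟶ (LargeSite.restriction.{w} J D h).obj L) :=
    ((LargeSite.cocontinuous.{w} J D).fullyFaithfulι.homEquiv).trans
      ((Functor.homEquivOfIsLeftKanExtension _ (unit K) L.obj).trans
        ((LargeSite.turnsHypercoversToColimits.{w} J D).fullyFaithfulι.homEquiv
          (X := K) (Y := (LargeSite.restriction.{w} J D h).obj L)).symm)
  have he (K L) (f : lanObj K ⟶ L) : (e K L f).hom = unit K ≫ Functor.whiskerLeft y f.hom := rfl
  have he' (K L L') (g : L ⟶ L') (f : lanObj K ⟶ L) :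
      e K L' (f ≫ g) = e K L f ≫ (LargeSite.restriction.{w} J D h).map g := by
    ext1
    exact (he K L' (f ≫ g)).trans (Category.assoc (unit K) (Functor.whiskerLeft y f.hom)
      (Functor.whiskerLeft y g.hom)).symm
  let adj := Adjunction.adjunctionOfEquivLeft e he'
  have hadj (K) : (adj.unit.app K).hom = unit K := by
    have h0 : adj.unit.app K = e K (lanObj K) (𝟙 _) := by
      simp [adj]
    rw [h0]
    exact (he K _ (𝟙 _)).trans (Category.comp_id _)
  have h1 (K) : IsIso (adj.unit.app K) := by
    have : IsIso ((LargeSite.turnsHypercoversToColimits.{w} J D).ι.map (adj.unit.app K)) := by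
      change IsIso (adj.unit.app K).hom
      rw [hadj]
      exact hunit K
    exact isIso_of_reflects_iso _ (LargeSite.turnsHypercoversToColimits.{w} J D).ι
  have hu : IsIso adj.unit := NatIso.isIso_of_isIso_app _
  refine ⟨h, Adjunction.leftAdjointOfEquiv e he', adj, hu, ?_, fun K => ?_⟩
  · have (L : (LargeSite.cocontinuous.{w} J D).FullSubcategory) : IsIso (adj.counit.app L) := by
      -- The unit being invertible, the triangle identity makes the restricted counit invertible,
      -- that is, the counit on representables.
      have h2 : IsIso ((LargeSite.restriction.{w} J D h).map (adj.counit.app L)) :=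
        IsIso.of_isIso_fac_left (adj.right_triangle_components L)
      have h3 : IsIso ((LargeSite.turnsHypercoversToColimits.{w} J D).ι.map
        ((LargeSite.restriction.{w} J D h).map (adj.counit.app L))) := inferInstance
      have : IsIso ((LargeSite.cocontinuous.{w} J D).ι.map (adj.counit.app L)) :=
        LargeSite.isIso_of_isIso_app_smallYoneda J (lanObj _).property L.property _ fun X =>
          NatIso.isIso_app_of_isIso ((LargeSite.turnsHypercoversToColimits.{w} J D).ι.map
            ((LargeSite.restriction.{w} J D h).map (adj.counit.app L))) X
      exact isIso_of_reflects_iso _ (LargeSite.cocontinuous.{w} J D).ι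
    exact NatIso.isIso_of_isIso_app _
  · rw [hadj]
    exact ⟨y.pointwiseLeftKanExtensionIsPointwiseLeftKanExtension K.obj⟩
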